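/- Let $U\subseteq\mathbb R^5$ be open, with coordinates $(x^1,x^2,x^3,y^4=v,y^5)$, and consider on $U$ the metric $$\delta s^2=g_1(dx^1)^2+g_2(dx^2)^2+g_3(dx^3)^2+h_4(\delta v)^2+h_5(\delta y^5)^2,\qquad \delta v=dv+w_i\,dx^i,\quad \delta y^5=dy^5+n_i\,dx^i,$$ where $g_1=\pm1$, $g_2,g_3$ are nowhere zero functions of $(x^2,x^3)$, $h_4,h_5$ are nowhere zero functions of $(x^1,x^2,x^3,v)$, and $w_i,n_i$ $(i=1,2,3)$ are functions of $(x^1,x^2,x^3,v)$, all of class $C^2$. Put $N_i^4=w_i$, $N_i^5=n_i$, $g_{ij}=\mathrm{diag}(g_1,g_2,g_3)$, $h_{ab}=\mathrm{diag}(h_4,h_5)$, and use the frame $\delta_i=\partial_i-N_i^a\partial_a$ $(i=1,2,3)$, $\delta_a=\partial_a$ $(a=4,5)$, dual to $(dx^i,\delta v,\delta y^5)$, with $[\delta_\alpha,\delta_\beta]=w^\gamma_{\alpha\beta}\delta_\gamma$. Let $D$ be the canonical d-connection, $D_{\delta_\gamma}\delta_\beta=\Gamma^\alpha_{\beta\gamma}\delta_\alpha$,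 whose nonzero coefficients are $$\begin{aligned} \Gamma^i_{jk}&=\tfrac12 g^{il}(\delta_kg_{lj}+\delta_jg_{lk}-\delta_lg_{jk}),\qquad \Gamma^i_{jc}=\tfrac12g^{ik}\partial_cg_{jk},\\ \Gamma^a_{bk}&=\partial_bN^a_k+\tfrac12h^{ac}(\delta_kh_{bc}-h_{dc}\partial_bN^d_k-h_{db}\partial_cN^d_k),\qquad \Gamma^a_{bc}=\tfrac12h^{ad}(\partial_ch_{db}+\partial_bh_{dc}-\partial_dh_{bc}). \end{aligned}$$ Let $$R_\beta{}^\alpha{}_{\gamma\tau}=\delta_\tau\Gamma^\alpha_{\beta\gamma}-\delta_\gamma\Gamma^\alpha_{\beta\tau}+\Gamma^\varphi_{\beta\gamma}\Gamma^\alpha_{\varphi\tau}-\Gamma^\varphi_{\beta\tau}\Gamma^\alpha_{\varphi\gamma}+\Gamma^\alpha_{\beta\varphi}w^\varphi_{\gamma\tau}$$ be its curvature, $R_{\beta\gamma}=R_\beta{}^\alpha{}_{\gamma\alpha}$ its Ricci tensor, $R$ its scalar curvature, and $G^\alpha_\beta=R^\alpha_\beta-\tfrac12R\,\delta^\alpha_\beta$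 its Einstein tensor, all with respect to this frame. Write $R^i_j=g^{ik}R_{kj}$ with $R_{ij}=R_i{}^k{}_{jk}$ for the horizontal Ricci tensor and $S^a_b=h^{ac}S_{cb}$ with $S_{ab}=R_a{}^c{}_{bc}$ for the vertical one. Then, on $U$: 1. $G^1_1=-(R^2_2+S^4_4)$, $\;G^2_2=G^3_3=-S^4_4$, $\;G^4_4=G^5_5=-R^2_2$. 2. The diagonal components of the Einstein tensor are governed by the two values $R^2_2$ and $S^4_4$: at each point all of them vanish if and only if $R^2_2=S^4_4=0$. These two values do not depend on the choice of the N-coefficients $w_i,n_i$. 3. Let $f^*=\partial f/\partial v$, $\beta=h_5^{**}-h_5^*(\ln\sqrt{|h_4h_5|})^*$ and $\alpha_i=\partial_ih_5^*-h_5^*\,\partial_i\ln\sqrt{|h_4h_5|}$. If all coefficients are $C^\infty$ and either $\beta$ vanishes nowhere on $U$, or $\beta=\alpha_1=\alpha_2=\alpha_3=0$ on $U$, then there are $C^\infty$ N-coefficients $w_i,n_i$, functions of $(x^1,x^2,x^3,v)$, such that for the metric with the same $g_1,g_2,g_3,h_4,h_5$ and these N-coefficients all non-diagonal components of the Ricci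 tensor and of the Einstein tensor vanish on $U$. -/

import Mathlib

open scoped ContDiff

noncomputable section

namespace AnholonomicFrame

/-- Indices of the splitting `5 = 3 + 2`. The holonomic indices `i = 1, 2, 3` are
`Sum.inl 0, Sum.inl 1, Sum.inl 2`; the anholonomic indices `a = 4, 5` are
`Sum.inr 0, Sum.inr 1`. -/
abbrev Idx : Type := Fin 3 ⊕ Fin 2

/-- Points of the coordinate space, with coordinates `u = (x¹, x², x³, y⁴ = v, y⁵)`. -/
abbrev Pt : Type := Idx → ℝ

/-- The coordinate vector `∂_α`. -/
def basisVec (α : Idx) : Pt := Pi.single α 1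

/-- The partial derivative `∂f / ∂u^α`. -/
def pd (α : Idx) (f : Pt → ℝ) (p : Pt) : ℝ := fderiv ℝ f p (basisVec α)

/-- A block metric `g_ij δx^i δx^j + h_ab δy^a δy^b`, given with respect to the N-elongated
co-frame with coefficients `N a i = N_i^a`. -/
structure DMetric where
  g : Pt → Matrix (Fin 3) (Fin 3) ℝ
  h : Pt → Matrix (Fin 2) (Fin 2) ℝ
  N : Fin 2 → Fin 3 → Pt → ℝ

namespace DMetric

variable (M : DMetric)

/-- The N-elongated frame `δ_i = ∂_i - N_i^a ∂_a`, `δ_a = ∂_a`. -/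
def frame : Idx → Pt → Pt
  | Sum.inl i, p => basisVec (Sum.inl i) - ∑ a, M.N a i p • basisVec (Sum.inr a)
  | Sum.inr a, _ => basisVec (Sum.inr a)

/-- The dual co-frame `δ^i = dx^i`, `δ^a = dy^a + N_i^a dx^i`, evaluated at a vector. -/
def coframe : Idx → Pt → Pt → ℝ
  | Sum.inl i, _, X => X (Sum.inl i)
  | Sum.inr a, p, X => X (Sum.inr a) + ∑ i, M.N a i p * X (Sum.inl i)

/-- The derivative `δ_α f` of a function along the frame. -/
def frameDeriv (α : Idx) (f : Pt → ℝ) (p : Pt) : ℝ := fderiv ℝ f p (M.frame α p)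

/-- The anholonomy coefficients `w^γ_{αβ}`, i.e. `[δ_α, δ_β] = w^γ_{αβ} δ_γ`. -/
def anholonomy (γ α β : Idx) (p : Pt) : ℝ :=
  M.coframe γ p (VectorField.lieBracket ℝ (M.frame α) (M.frame β) p)

/-- The components of the metric with respect to the N-elongated frame. -/
def metric (p : Pt) : Matrix Idx Idx ℝ := Matrix.fromBlocks (M.g p) 0 0 (M.h p)

/-- The coefficients `Γ^α_{βγ}` of the canonical d-connection,
`D_{δ_γ} δ_β = Γ^α_{βγ} δ_α`. The four blocks are `L^i_{jk}`, `C^i_{jc}`, `L^a_{bk}` and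
`C^a_{bc}`. -/
def conn : Idx → Idx → Idx → Pt → ℝ
  | Sum.inl i, Sum.inl j, Sum.inl k, p =>
      (1 / 2) * ∑ l, (M.g p)⁻¹ i l *
        (M.frameDeriv (Sum.inl k) (fun q => M.g q l j) p
          + M.frameDeriv (Sum.inl j) (fun q => M.g q l k) p
          - M.frameDeriv (Sum.inl l) (fun q => M.g q j k) p)
  | Sum.inl i, Sum.inl j, Sum.inr c, p =>
      (1 / 2) * ∑ k, (M.g p)⁻¹ i k * M.frameDeriv (Sum.inr c) (fun q => M.g q j k) p
  | Sum.inr a, Sum.inr b, Sum.inl k, p =>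
      M.frameDeriv (Sum.inr b) (M.N a k) p
        + (1 / 2) * ∑ c, (M.h p)⁻¹ a c *
          (M.frameDeriv (Sum.inl k) (fun q => M.h q b c) p
            - ∑ d, M.h p d c * M.frameDeriv (Sum.inr b) (M.N d k) p
            - ∑ d, M.h p d b * M.frameDeriv (Sum.inr c) (M.N d k) p)
  | Sum.inr a, Sum.inr b, Sum.inr c, p =>
      (1 / 2) * ∑ d, (M.h p)⁻¹ a d *
        (M.frameDeriv (Sum.inr c) (fun q => M.h q d b) p
          + M.frameDeriv (Sum.inr b) (fun q => M.h q d c) p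
          - M.frameDeriv (Sum.inr d) (fun q => M.h q b c) p)
  | Sum.inl _, Sum.inr _, _, _ => 0
  | Sum.inr _, Sum.inl _, _, _ => 0

/-- The curvature `R_β^α_{γτ}` of the canonical d-connection,
`R(δ_τ, δ_γ) δ_β = R_β^α_{γτ} δ_α`. -/
def curvature (β α γ τ : Idx) (p : Pt) : ℝ :=
  M.frameDeriv τ (M.conn α β γ) p - M.frameDeriv γ (M.conn α β τ) p
    + ∑ φ, M.conn φ β γ p * M.conn α φ τ p
    - ∑ φ, M.conn φ β τ p * M.conn α φ γ p
    + ∑ φ, M.conn α β φ p * M.anholonomy φ γ τ p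

/-- The Ricci tensor `R_{βγ} = R_β^α_{γα}` (not symmetric in general). -/
def ricci (β γ : Idx) (p : Pt) : ℝ := ∑ α, M.curvature β α γ α p

/-- The scalar curvature `R = g^{βγ} R_{βγ}`. -/
def scalar (p : Pt) : ℝ := ∑ β, ∑ γ, (M.metric p)⁻¹ β γ * M.ricci β γ p

/-- The mixed Ricci tensor `R^α_β = g^{αγ} R_{γβ}`. -/
def ricciMixed (α β : Idx) (p : Pt) : ℝ := ∑ γ, (M.metric p)⁻¹ α γ * M.ricci γ β p

/-- The Einstein tensor `G^α_β = R^α_β - (1/2) R δ^α_β`. -/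
def einstein (α β : Idx) (p : Pt) : ℝ :=
  M.ricciMixed α β p - (1 / 2) * M.scalar p * (if α = β then 1 else 0)

/-- The horizontal Ricci tensor `R_{ij} = R_i^k_{jk}` (`k` horizontal). -/
def hRicci (i j : Fin 3) (p : Pt) : ℝ :=
  ∑ k : Fin 3, M.curvature (Sum.inl i) (Sum.inl k) (Sum.inl j) (Sum.inl k) p

/-- `R^i_j = g^{ik} R_{kj}`. -/
def hRicciMixed (i j : Fin 3) (p : Pt) : ℝ := ∑ k, (M.g p)⁻¹ i k * M.hRicci k j p

/-- The vertical Ricci tensor `S_{ab} = S_a^c_{bc}` (`c` vertical). -/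
def vRicci (a b : Fin 2) (p : Pt) : ℝ :=
  ∑ c : Fin 2, M.curvature (Sum.inr a) (Sum.inr c) (Sum.inr b) (Sum.inr c) p

/-- `S^a_b = h^{ac} S_{cb}`. -/
def vRicciMixed (a b : Fin 2) (p : Pt) : ℝ := ∑ c, (M.h p)⁻¹ a c * M.vRicci c b p

end DMetric

/-- Coefficients of the ansatz
`g₁ (dx¹)² + g₂ (dx²)² + g₃ (dx³)² + h₄ (δv)² + h₅ (δy⁵)²`,
`δv = dv + w_i dx^i`, `δy⁵ = dy⁵ + n_i dx^i`, with `g₁` constant, `g₂, g₃` functions of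
`(x², x³)`, and `h₄, h₅, w_i, n_i` functions of `(x¹, x², x³, v)`. -/
structure Ansatz where
  g₁ : ℝ
  g₂ : ℝ → ℝ → ℝ
  g₃ : ℝ → ℝ → ℝ
  h₄ : (Fin 3 → ℝ) → ℝ → ℝ
  h₅ : (Fin 3 → ℝ) → ℝ → ℝ
  w : Fin 3 → (Fin 3 → ℝ) → ℝ → ℝ
  n : Fin 3 → (Fin 3 → ℝ) → ℝ → ℝ

/-- A function of `(x², x³)` as a function on the coordinate space. -/
def lift23 (f : ℝ → ℝ → ℝ) (p : Pt) : ℝ := f (p (Sum.inl 1)) (p (Sum.inl 2))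

/-- A function of `(x¹, x², x³, v)` as a function on the coordinate space. -/
def liftXV (f : (Fin 3 → ℝ) → ℝ → ℝ) (p : Pt) : ℝ :=
  f (fun i => p (Sum.inl i)) (p (Sum.inr 0))

namespace Ansatz

variable (D : Ansatz)

/-- The d-metric of the ansatz, with `N_i^4 = w_i` and `N_i^5 = n_i`. -/
def toDMetric : DMetric where
  g p := Matrix.diagonal ![D.g₁, lift23 D.g₂ p, lift23 D.g₃ p]
  h p := Matrix.diagonal ![liftXV D.h₄ p, liftXV D.h₅ p]
  N a i := ![liftXV (D.w i), liftXV (D.n i)] a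

/-- On `U` the coefficients are of class `C^r` and the metric is nondegenerate; `g₁ = ±1`. -/
structure IsRegularOn (r : WithTop ℕ∞) (U : Set Pt) : Prop where
  g₁_eq : D.g₁ = 1 ∨ D.g₁ = -1
  g₂_smooth : ContDiffOn ℝ r (lift23 D.g₂) U
  g₃_smooth : ContDiffOn ℝ r (lift23 D.g₃) U
  h₄_smooth : ContDiffOn ℝ r (liftXV D.h₄) U
  h₅_smooth : ContDiffOn ℝ r (liftXV D.h₅) U
  w_smooth : ∀ i, ContDiffOn ℝ r (liftXV (D.w i)) U
  n_smooth : ∀ i, ContDiffOn ℝ r (liftXV (D.n i)) U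
  g₂_ne : ∀ p ∈ U, lift23 D.g₂ p ≠ 0
  g₃_ne : ∀ p ∈ U, lift23 D.g₃ p ≠ 0
  h₄_ne : ∀ p ∈ U, liftXV D.h₄ p ≠ 0
  h₅_ne : ∀ p ∈ U, liftXV D.h₅ p ≠ 0

/-- The same ansatz with other N-coefficients. -/
def withN (w' n' : Fin 3 → (Fin 3 → ℝ) → ℝ → ℝ) : Ansatz := { D with w := w', n := n' }

/-- `∂h₅ / ∂v`. -/
def h₅star : Pt → ℝ := pd (Sum.inr 0) (liftXV D.h₅)

/-- `ln √|h₄ h₅|`. -/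
def logRoot (p : Pt) : ℝ := Real.log (Real.sqrt |liftXV D.h₄ p * liftXV D.h₅ p|)

/-- `α_i = ∂_i h₅* - h₅* ∂_i ln √|h₄ h₅|`. -/
def alphaCoeff (i : Fin 3) (p : Pt) : ℝ :=
  pd (Sum.inl i) D.h₅star p - D.h₅star p * pd (Sum.inl i) D.logRoot p

/-- `β = h₅** - h₅* (ln √|h₄ h₅|)*`. -/
def betaCoeff (p : Pt) : ℝ :=
  pd (Sum.inr 0) D.h₅star p - D.h₅star p * pd (Sum.inr 0) D.logRoot p

end Ansatz

end AnholonomicFrame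

end

/-! The canonical d-connection preserves the splitting, so $R_{i\gamma}$ is a trace over horizontal
indices only and $R_{a\gamma}$ over vertical ones (`ricci_inl`, `ricci_inr`). Since $g_i$ does not
depend on $v,y^5$, the N-coefficients drop out of the horizontal block: $R_{ij}$ is the Ricci tensor
of $\mathrm{diag}(g_1,g_2,g_3)$, a line times a surface. Likewise $S_{ab}$ is the Ricci tensor of
the surface metric $\mathrm{diag}(h_4,h_5)$ with $x$ as a parameter (`hRicci_eq_diagRicci`,
`vRicci_eq_diagRicci`). On a surface Ricci is a multiple of the metric, so $R^1_1=0$, $R^2_2=R^3_3$,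
$S^4_4=S^5_5$, and $R=2(R^2_2+S^4_4)$; claims 1 and 2 follow.

Off the diagonal, $R_{ia}=0$ always, so only $R_{ai}$ depends on N. For $n_i=0$ one finds $R_{5i}=0$
and $R_{4i}=-\frac1{2h_5}(\alpha_i-w_i\beta)$ (`ricci_inr_inl`). This is algebraic in $w_i$, solved
by $w_i=\alpha_i/\beta$, or by $w_i=0$ if $\alpha_i=\beta=0$. -/

noncomputable section

namespace AnholonomicFrame

/-! ### Partial derivatives and independence of a coordinate -/

section PartialDerivatives

variable {α β : Idx} {f g : Pt → ℝ} {p : Pt}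

theorem pd_const (c : ℝ) : pd α (fun _ => c) p = 0 := by simp [pd]

theorem pd_add (hf : DifferentiableAt ℝ f p) (hg : DifferentiableAt ℝ g p) :
    pd α (fun q => f q + g q) p = pd α f p + pd α g p := by
  simp [pd, fderiv_fun_add hf hg]

theorem pd_sub (hf : DifferentiableAt ℝ f p) (hg : DifferentiableAt ℝ g p) :
    pd α (fun q => f q - g q) p = pd α f p - pd α g p := by
  simp [pd, fderiv_fun_sub hf hg]

theorem pd_mul (hf : DifferentiableAt ℝ f p) (hg : DifferentiableAt ℝ g p) :
    pd α (fun q => f q * g q) p = f p * pd α g p + g p * pd α f p := by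
  simp [pd, fderiv_fun_mul hf hg]

theorem pd_ite (c : Prop) [Decidable c] :
    pd α (fun q => if c then f q else 0) p = if c then pd α f p else 0 := by
  split_ifs <;> simp [pd]

theorem pd_half_inv_mul (hf : DifferentiableAt ℝ f p) (hg : DifferentiableAt ℝ g p)
    (h0 : f p ≠ 0) :
    pd α (fun q => 1 / 2 * (f q)⁻¹ * g q) p
      = 1 / 2 * ((f p)⁻¹ * pd α g p - (f p)⁻¹ ^ 2 * pd α f p * g p) := by
  have hi : HasFDerivAt (fun q => (f q)⁻¹) _ p :=
    (hasDerivAt_inv h0).comp_hasFDerivAt p hf.hasFDerivAt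
  have h : HasFDerivAt (fun q => 1 / 2 * (f q)⁻¹ * g q) _ p :=
    (hi.const_mul (1 / 2)).mul hg.hasFDerivAt
  simp only [pd, h.fderiv]
  simp
  ring

theorem ContDiffAt.pd {m n : WithTop ℕ∞} (hf : ContDiffAt ℝ n f p) (h : m + 1 ≤ n) :
    ContDiffAt ℝ m (pd α f) p :=
  (hf.fderiv_right h).clm_apply contDiffAt_const

theorem differentiableAt_pd (hf : ContDiffAt ℝ 2 f p) : DifferentiableAt ℝ (pd α f) p :=
  (ContDiffAt.pd (m := 1) hf (by norm_num)).differentiableAt (by norm_num)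

theorem pd_comm (hf : ContDiffAt ℝ 2 f p) : pd α (pd β f) p = pd β (pd α f) p := by
  have hs : IsSymmSndFDerivAt ℝ f p := hf.isSymmSndFDerivAt (by simp)
  have hd : DifferentiableAt ℝ (fderiv ℝ f) p :=
    (hf.fderiv_right (m := 1) (by norm_num)).differentiableAt (by norm_num)
  have key : ∀ α β : Idx, pd α (pd β f) p
      = fderiv ℝ (fderiv ℝ f) p (basisVec α) (basisVec β) := by
    intro α β
    have : pd β f = fun q => fderiv ℝ f q (basisVec β) := rfl
    rw [this, pd, fderiv_clm_apply hd (differentiableAt_const _)]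
    simp
  rw [key, key, hs.eq]

/-- The function does not depend on the coordinate `u^α`. -/
def IndepOf (α : Idx) (f : Pt → ℝ) : Prop := ∀ (p : Pt) (t : ℝ), f (p + t • basisVec α) = f p

theorem IndepOf.pd_eq_zero (h : IndepOf α f) : pd α f p = 0 := by
  by_cases hf : DifferentiableAt ℝ f p
  · have h1 : HasDerivAt (fun t : ℝ => p + t • basisVec α) (basisVec α) 0 := by
      simpa using ((hasDerivAt_id (0 : ℝ)).smul_const (basisVec α)).const_add p
    have hf' : HasFDerivAt f (fderiv ℝ f p) (p + (0 : ℝ) • basisVec α) := by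
      simpa using hf.hasFDerivAt
    have h2 := hf'.comp_hasDerivAt (0 : ℝ) h1
    have h3 : (f ∘ fun t : ℝ => p + t • basisVec α) = fun _ => f p := funext fun t => h p t
    rw [h3] at h2
    exact h2.unique (hasDerivAt_const _ _)
  -- `fderiv` is zero by default here, so no regularity is needed.
  · simp [pd, fderiv_zero_of_not_differentiableAt hf]

theorem IndepOf.pd (h : IndepOf α f) : IndepOf α (pd β f) := by
  intro p t
  have : (fun q => f (q + t • basisVec α)) = f := funext fun q => h q t
  simp only [AnholonomicFrame.pd]
  rw [← fderiv_comp_add_right, this]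

end PartialDerivatives

/-! ### Christoffel symbols of a diagonal metric -/

section DiagonalMetric

variable {κ : Type} [DecidableEq κ]

/-- `∂_k g_{ij} + ∂_j g_{ik} - ∂_i g_{jk}` for the diagonal metric with entries `G`,
where the coordinate directions are given by `e`. -/
def diagFirstKind (e : κ → Idx) (G : κ → Pt → ℝ) (i j k : κ) (p : Pt) : ℝ :=
  (if i = j then pd (e k) (G i) p else 0) + (if i = k then pd (e j) (G i) p else 0)
    - (if j = k then pd (e i) (G j) p else 0)

/-- The Christoffel symbols of the diagonal metric with entries `G`. -/
def diagChristoffel (e : κ → Idx) (G : κ → Pt → ℝ) (i j k : κ) (p : Pt) : ℝ :=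
  1 / 2 * (G i p)⁻¹ * diagFirstKind e G i j k p

/-- The Ricci tensor of the diagonal metric with entries `G`. -/
def diagRicci [Fintype κ] (e : κ → Idx) (G : κ → Pt → ℝ) (i j : κ) (p : Pt) : ℝ :=
  ∑ k, (pd (e k) (diagChristoffel e G k i j) p - pd (e j) (diagChristoffel e G k i k) p
    + ∑ l, diagChristoffel e G l i j p * diagChristoffel e G k l k p
    - ∑ l, diagChristoffel e G l i k p * diagChristoffel e G k l j p)

variable {e : κ → Idx} {G : κ → Pt → ℝ} {p : Pt}

theorem pd_diagFirstKind (hG : ∀ i, ContDiffAt ℝ 2 (G i) p) (m : Idx) (i j k : κ) :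
    pd m (diagFirstKind e G i j k) p
      = (if i = j then pd m (pd (e k) (G i)) p else 0)
        + (if i = k then pd m (pd (e j) (G i)) p else 0)
        - (if j = k then pd m (pd (e i) (G j)) p else 0) := by
  have d : ∀ (c : Prop) [Decidable c] (i k : κ),
      DifferentiableAt ℝ (fun q => if c then pd (e k) (G i) q else 0) p := by
    intro c _ i k
    split_ifs
    · exact differentiableAt_pd (hG i)
    · exact differentiableAt_const _
  unfold diagFirstKind
  rw [pd_sub ((d _ _ _).fun_add (d _ _ _)) (d _ _ _), pd_add (d _ _ _) (d _ _ _), pd_ite, pd_ite,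
    pd_ite]

theorem differentiableAt_diagFirstKind (hG : ∀ i, ContDiffAt ℝ 2 (G i) p) (i j k : κ) :
    DifferentiableAt ℝ (diagFirstKind e G i j k) p := by
  have d : ∀ (c : Prop) [Decidable c] (i k : κ),
      DifferentiableAt ℝ (fun q => if c then pd (e k) (G i) q else 0) p := by
    intro c _ i k
    split_ifs
    · exact differentiableAt_pd (hG i)
    · exact differentiableAt_const _
  exact ((d _ _ _).add (d _ _ _)).sub (d _ _ _)

theorem pd_diagChristoffel (hG : ∀ i, ContDiffAt ℝ 2 (G i) p) (h0 : ∀ i, G i p ≠ 0)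
    (m : Idx) (i j k : κ) :
    pd m (diagChristoffel e G i j k) p
      = 1 / 2 * ((G i p)⁻¹ * ((if i = j then pd m (pd (e k) (G i)) p else 0)
        + (if i = k then pd m (pd (e j) (G i)) p else 0)
        - (if j = k then pd m (pd (e i) (G j)) p else 0))
        - (G i p)⁻¹ ^ 2 * pd m (G i) p * diagFirstKind e G i j k p) := by
  unfold diagChristoffel
  rw [pd_half_inv_mul ((hG i).differentiableAt (by norm_num))
    (differentiableAt_diagFirstKind hG i j k) (h0 i), pd_diagFirstKind hG]

theorem pd_diagChristoffel_of_indepOf (hG : ∀ i, ContDiffAt ℝ 2 (G i) p)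
    (h0 : ∀ i, G i p ≠ 0) {m : Idx} (hm : ∀ i, IndepOf m (G i)) (i j k : κ) :
    pd m (diagChristoffel e G i j k) p = 0 := by
  rw [pd_diagChristoffel hG h0]
  simp [(hm _).pd.pd_eq_zero, (hm _).pd_eq_zero]

end DiagonalMetric

/-! ### Ricci tensor of a surface, and of a line times a surface -/

section Dimensions

variable {p : Pt}

/-- In dimension two the Ricci tensor is the Gauss curvature times the metric. Independence of the
second coordinate makes the explicit computation short. -/
theorem diagRicci_fin_two_of_indepOf {e : Fin 2 → Idx} {G : Fin 2 → Pt → ℝ}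
    (hG : ∀ i, ContDiffAt ℝ 2 (G i) p) (h0 : ∀ i, G i p ≠ 0) (h1 : ∀ i, IndepOf (e 1) (G i)) :
    diagRicci e G 0 1 p = 0 ∧ diagRicci e G 1 0 p = 0 ∧
      (G 1 p)⁻¹ * diagRicci e G 1 1 p = (G 0 p)⁻¹ * diagRicci e G 0 0 p := by
  have z := fun i => (h1 i).pd_eq_zero (p := p)
  have zz := fun β i => ((h1 i).pd (β := β)).pd_eq_zero (p := p)
  -- `z` holds at `p` only and cannot be differentiated; symmetry of second derivatives gives the
  -- other order.
  have zz' := fun β i => (pd_comm (hG i)).trans (zz β i)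
  have a0 := h0 0
  have b0 := h0 1
  simp only [diagRicci, Fin.sum_univ_two, pd_diagChristoffel hG h0]
  simp [diagChristoffel, diagFirstKind, z, zz, zz']
  field_simp
  ring

/-- A constant first entry and independence of the first coordinate make the metric a product of a
flat line and a surface. -/
theorem diagRicci_fin_three_of_indepOf {e : Fin 3 → Idx} {G : Fin 3 → Pt → ℝ}
    (hG : ∀ i, ContDiffAt ℝ 2 (G i) p) (h0 : ∀ i, G i p ≠ 0)
    (h1 : ∀ i, IndepOf (e 0) (G i)) (hc : ∃ c, G 0 = fun _ => c) :
    (∀ i j, i ≠ j → diagRicci e G i j p = 0) ∧ diagRicci e G 0 0 p = 0 ∧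
      (G 2 p)⁻¹ * diagRicci e G 2 2 p = (G 1 p)⁻¹ * diagRicci e G 1 1 p := by
  have z := fun i => (h1 i).pd_eq_zero (p := p)
  have zz := fun β i => ((h1 i).pd (β := β)).pd_eq_zero (p := p)
  have zz' := fun β i => (pd_comm (hG i)).trans (zz β i)
  have c1 : ∀ α q, pd α (G 0) q = 0 := by
    obtain ⟨c, hc⟩ := hc
    intro α q
    rw [hc, pd_const]
  have c2 : ∀ α β, pd α (pd β (G 0)) p = 0 := by
    intro α β
    have : pd β (G 0) = fun _ => 0 := funext (c1 β)
    rw [this, pd_const]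
  have s1 := pd_comm (α := e 1) (β := e 2) (hG 1)
  have s2 := pd_comm (α := e 1) (β := e 2) (hG 2)
  have a0 := h0 1
  have b0 := h0 2
  refine ⟨?_, ?_, ?_⟩
  · intro i j hij
    simp only [diagRicci, Fin.sum_univ_three, pd_diagChristoffel hG h0]
    fin_cases i <;> fin_cases j <;>
      simp [diagChristoffel, diagFirstKind, z, zz, zz', c1, c2, s1, s2] at hij ⊢ <;>
      field_simp <;> ring
  · simp only [diagRicci, Fin.sum_univ_three, pd_diagChristoffel hG h0]
    simp [diagChristoffel, diagFirstKind, z, zz, c1, c2]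
  · simp only [diagRicci, Fin.sum_univ_three, pd_diagChristoffel hG h0]
    simp [diagChristoffel, diagFirstKind, z, zz, c1, c2]
    field_simp
    ring

end Dimensions

end AnholonomicFrame

end

/-! ### Frame, anholonomy and curvature for a general block metric -/

noncomputable section

namespace AnholonomicFrame

namespace DMetric

variable (M : DMetric) {p : Pt}

theorem frameDeriv_inr (a : Fin 2) (f : Pt → ℝ) :
    M.frameDeriv (Sum.inr a) f p = pd (Sum.inr a) f p := rfl

theorem frameDeriv_inl (i : Fin 3) (f : Pt → ℝ) :
    M.frameDeriv (Sum.inl i) f p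
      = pd (Sum.inl i) f p - ∑ a, M.N a i p * pd (Sum.inr a) f p := by
  simp [frameDeriv, frame, pd, map_sub]

theorem frameDeriv_congr {f g : Pt → ℝ} (α : Idx) (h : f =ᶠ[nhds p] g) :
    M.frameDeriv α f p = M.frameDeriv α g p := by
  simp only [frameDeriv, h.fderiv_eq]

theorem frameDeriv_zero (α : Idx) : M.frameDeriv α (fun _ => 0) p = 0 := by
  simp [frameDeriv]

theorem fderiv_frame_inr (a : Fin 2) (X : Pt) : fderiv ℝ (M.frame (Sum.inr a)) p X = 0 := by
  have : M.frame (Sum.inr a) = fun _ => basisVec (Sum.inr a) := rfl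
  simp [this]

theorem fderiv_frame_inl (hN : ∀ a i, DifferentiableAt ℝ (M.N a i) p) (i : Fin 3) (X : Pt) :
    fderiv ℝ (M.frame (Sum.inl i)) p X
      = -∑ a, fderiv ℝ (M.N a i) p X • (basisVec (Sum.inr a) : Pt) := by
  have h : HasFDerivAt (M.frame (Sum.inl i)) _ p :=
    (HasFDerivAt.fun_sum (u := Finset.univ) fun a _ =>
      (hN a i).hasFDerivAt.smul_const (basisVec (Sum.inr a) : Pt)).const_sub
      (basisVec (Sum.inl i))
  rw [h.fderiv]
  simp

/-- The horizontal components of the frame fields are constant, so all brackets are vertical. -/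
theorem anholonomy_inl (hN : ∀ a i, DifferentiableAt ℝ (M.N a i) p) (k : Fin 3) (α β : Idx) :
    M.anholonomy (Sum.inl k) α β p = 0 := by
  have key : ∀ α X, fderiv ℝ (M.frame α) p X (Sum.inl k) = 0 := by
    rintro (i | a) X
    · rw [M.fderiv_frame_inl hN]
      simp [basisVec]
    · simp [M.fderiv_frame_inr]
  simp [anholonomy, coframe, VectorField.lieBracket, key]

theorem anholonomy_inr_inr (γ : Idx) (a b : Fin 2) :
    M.anholonomy γ (Sum.inr a) (Sum.inr b) p = 0 := by
  cases γ <;> simp [anholonomy, coframe, VectorField.lieBracket, fderiv_frame_inr]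

/-- The only brackets that matter for the ansatz: the vertical $w^c_{ij}$ meet Ricci only through
$\Gamma^k_{lc}$, which vanishes there. -/
theorem anholonomy_inr_inl_inr (hN : ∀ a i, DifferentiableAt ℝ (M.N a i) p) (c : Fin 2)
    (i : Fin 3) (b : Fin 2) :
    M.anholonomy (Sum.inr c) (Sum.inl i) (Sum.inr b) p = pd (Sum.inr b) (M.N c i) p := by
  simp only [anholonomy, coframe, VectorField.lieBracket, fderiv_frame_inr,
    M.fderiv_frame_inl hN]
  have : M.frame (Sum.inr b) p = basisVec (Sum.inr b) := rfl
  fin_cases c <;> simp [this, basisVec, pd]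

theorem curvature_inr_inl (a : Fin 2) (k : Fin 3) (γ τ : Idx) :
    M.curvature (Sum.inr a) (Sum.inl k) γ τ p = 0 := by
  have h : ∀ γ, M.conn (Sum.inl k) (Sum.inr a) γ = fun _ => 0 := by
    rintro (i | b) <;> rfl
  simp only [curvature, h, frameDeriv_zero, Fintype.sum_sum_type]
  simp [conn]

theorem curvature_inl_inr (i : Fin 3) (a : Fin 2) (γ τ : Idx) :
    M.curvature (Sum.inl i) (Sum.inr a) γ τ p = 0 := by
  have h : ∀ γ, M.conn (Sum.inr a) (Sum.inl i) γ = fun _ => 0 := by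
    rintro (i | b) <;> rfl
  simp only [curvature, h, frameDeriv_zero, Fintype.sum_sum_type]
  simp [conn]

theorem ricci_inl (i : Fin 3) (γ : Idx) :
    M.ricci (Sum.inl i) γ p = ∑ k, M.curvature (Sum.inl i) (Sum.inl k) γ (Sum.inl k) p := by
  simp [ricci, Fintype.sum_sum_type, curvature_inl_inr]

theorem ricci_inr (a : Fin 2) (γ : Idx) :
    M.ricci (Sum.inr a) γ p = ∑ c, M.curvature (Sum.inr a) (Sum.inr c) γ (Sum.inr c) p := by
  simp [ricci, Fintype.sum_sum_type, curvature_inr_inl]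

theorem ricci_inl_inl (i j : Fin 3) : M.ricci (Sum.inl i) (Sum.inl j) p = M.hRicci i j p :=
  M.ricci_inl i _

theorem ricci_inr_inr (a b : Fin 2) : M.ricci (Sum.inr a) (Sum.inr b) p = M.vRicci a b p :=
  M.ricci_inr a _

end DMetric

/-! ### The ansatz: connection blocks, Ricci and Einstein tensors -/

theorem indepOf_lift23 (f : ℝ → ℝ → ℝ) {α : Idx} (h1 : α ≠ Sum.inl 1) (h2 : α ≠ Sum.inl 2) :
    IndepOf α (lift23 f) := by
  intro p t
  simp [lift23, basisVec, h1.symm, h2.symm]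

theorem indepOf_liftXV (f : (Fin 3 → ℝ) → ℝ → ℝ) : IndepOf (Sum.inr 1) (liftXV f) := by
  intro p t
  simp [liftXV, basisVec]

theorem inv_diagonal_apply {ι : Type*} [Fintype ι] [DecidableEq ι] {d : ι → ℝ}
    (hd : ∀ i, d i ≠ 0) (i j : ι) :
    (Matrix.diagonal d)⁻¹ i j = if i = j then (d i)⁻¹ else 0 := by
  have : (Matrix.diagonal d)⁻¹ = Matrix.diagonal fun i => (d i)⁻¹ := by
    apply Matrix.inv_eq_left_inv
    rw [Matrix.diagonal_mul_diagonal, ← Matrix.diagonal_one]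
    congr 1
    funext i
    exact inv_mul_cancel₀ (hd i)
  rw [this, Matrix.diagonal_apply]

namespace Ansatz

variable (D : Ansatz)

/-- The horizontal coefficients `g₁, g₂, g₃` as functions on the coordinate space. -/
def hCoeff : Fin 3 → Pt → ℝ := ![fun _ => D.g₁, lift23 D.g₂, lift23 D.g₃]

/-- The vertical coefficients `h₄, h₅` as functions on the coordinate space. -/
def vCoeff : Fin 2 → Pt → ℝ := ![liftXV D.h₄, liftXV D.h₅]

theorem toDMetric_g (p : Pt) : D.toDMetric.g p = Matrix.diagonal fun i => D.hCoeff i p := by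
  simp only [toDMetric]
  congr 1
  funext i
  fin_cases i <;> rfl

theorem toDMetric_h (p : Pt) : D.toDMetric.h p = Matrix.diagonal fun a => D.vCoeff a p := by
  simp only [toDMetric]
  congr 1
  funext i
  fin_cases i <;> rfl

theorem metric_eq_diagonal (p : Pt) :
    D.toDMetric.metric p
      = Matrix.diagonal (Sum.elim (fun i => D.hCoeff i p) fun a => D.vCoeff a p) := by
  rw [DMetric.metric, toDMetric_g, toDMetric_h, Matrix.fromBlocks_diagonal]

variable {D} {U : Set Pt} {p : Pt}

theorem indepOf_hCoeff (i : Fin 3) {α : Idx} (h1 : α ≠ Sum.inl 1) (h2 : α ≠ Sum.inl 2) :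
    IndepOf α (D.hCoeff i) := by
  fin_cases i
  · exact fun _ _ => rfl
  · exact indepOf_lift23 _ h1 h2
  · exact indepOf_lift23 _ h1 h2

theorem indepOf_vCoeff (a : Fin 2) : IndepOf (Sum.inr 1) (D.vCoeff a) := by
  fin_cases a <;> exact indepOf_liftXV _

theorem indepOf_N (a : Fin 2) (i : Fin 3) : IndepOf (Sum.inr 1) (D.toDMetric.N a i) := by
  fin_cases a <;> exact indepOf_liftXV _

namespace IsRegularOn

theorem contDiffAt_hCoeff {r : WithTop ℕ∞} (hD : D.IsRegularOn r U) (hU : IsOpen U)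
    (hp : p ∈ U) (i : Fin 3) : ContDiffAt ℝ r (D.hCoeff i) p := by
  fin_cases i
  · exact contDiffAt_const
  · exact hD.g₂_smooth.contDiffAt (hU.mem_nhds hp)
  · exact hD.g₃_smooth.contDiffAt (hU.mem_nhds hp)

theorem contDiffAt_vCoeff {r : WithTop ℕ∞} (hD : D.IsRegularOn r U) (hU : IsOpen U)
    (hp : p ∈ U) (a : Fin 2) : ContDiffAt ℝ r (D.vCoeff a) p := by
  fin_cases a
  · exact hD.h₄_smooth.contDiffAt (hU.mem_nhds hp)
  · exact hD.h₅_smooth.contDiffAt (hU.mem_nhds hp)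

theorem contDiffAt_N {r : WithTop ℕ∞} (hD : D.IsRegularOn r U) (hU : IsOpen U)
    (hp : p ∈ U) (a : Fin 2) (i : Fin 3) : ContDiffAt ℝ r (D.toDMetric.N a i) p := by
  fin_cases a
  · exact (hD.w_smooth i).contDiffAt (hU.mem_nhds hp)
  · exact (hD.n_smooth i).contDiffAt (hU.mem_nhds hp)

theorem hCoeff_ne {r : WithTop ℕ∞} (hD : D.IsRegularOn r U) (hp : p ∈ U) (i : Fin 3) :
    D.hCoeff i p ≠ 0 := by
  fin_cases i
  · rcases hD.g₁_eq with h | h <;> simp [hCoeff, h]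
  · exact hD.g₂_ne p hp
  · exact hD.g₃_ne p hp

theorem vCoeff_ne {r : WithTop ℕ∞} (hD : D.IsRegularOn r U) (hp : p ∈ U) (a : Fin 2) :
    D.vCoeff a p ≠ 0 := by
  fin_cases a
  · exact hD.h₄_ne p hp
  · exact hD.h₅_ne p hp

theorem of_le {r s : WithTop ℕ∞} (hD : D.IsRegularOn r U) (h : s ≤ r) : D.IsRegularOn s U where
  g₁_eq := hD.g₁_eq
  g₂_smooth := hD.g₂_smooth.of_le h
  g₃_smooth := hD.g₃_smooth.of_le h
  h₄_smooth := hD.h₄_smooth.of_le h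
  h₅_smooth := hD.h₅_smooth.of_le h
  w_smooth i := (hD.w_smooth i).of_le h
  n_smooth i := (hD.n_smooth i).of_le h
  g₂_ne := hD.g₂_ne
  g₃_ne := hD.g₃_ne
  h₄_ne := hD.h₄_ne
  h₅_ne := hD.h₅_ne

variable (hD : D.IsRegularOn 2 U) (hU : IsOpen U) (hp : p ∈ U)

include hD hp in
theorem inv_g_apply (i j : Fin 3) :
    (D.toDMetric.g p)⁻¹ i j = if i = j then (D.hCoeff i p)⁻¹ else 0 := by
  rw [toDMetric_g, inv_diagonal_apply (hD.hCoeff_ne hp)]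

include hD hp in
theorem inv_h_apply (i j : Fin 2) :
    (D.toDMetric.h p)⁻¹ i j = if i = j then (D.vCoeff i p)⁻¹ else 0 := by
  rw [toDMetric_h, inv_diagonal_apply (hD.vCoeff_ne hp)]

include hD hp in
theorem inv_metric_apply (α β : Idx) :
    (D.toDMetric.metric p)⁻¹ α β = if α = β then
      (Sum.elim (fun i => D.hCoeff i p) (fun a => D.vCoeff a p) α)⁻¹ else 0 := by
  rw [metric_eq_diagonal, inv_diagonal_apply]
  rintro (i | a)
  · exact hD.hCoeff_ne hp i
  · exact hD.vCoeff_ne hp a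

theorem frameDeriv_hCoeff (k i : Fin 3) :
    D.toDMetric.frameDeriv (Sum.inl k) (D.hCoeff i) p = pd (Sum.inl k) (D.hCoeff i) p := by
  rw [DMetric.frameDeriv_inl]
  simp [(indepOf_hCoeff (D := D) i (α := Sum.inr _) (by simp) (by simp)).pd_eq_zero]

theorem g_entry (i j : Fin 3) :
    (fun q => D.toDMetric.g q i j) = if i = j then D.hCoeff i else fun _ => 0 := by
  funext q
  rw [toDMetric_g, Matrix.diagonal_apply]
  split_ifs <;> rfl

theorem h_entry (i j : Fin 2) :
    (fun q => D.toDMetric.h q i j) = if i = j then D.vCoeff i else fun _ => 0 := by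
  funext q
  rw [toDMetric_h, Matrix.diagonal_apply]
  split_ifs <;> rfl

include hD hp in
theorem conn_inl_inl_inl (i j k : Fin 3) :
    D.toDMetric.conn (Sum.inl i) (Sum.inl j) (Sum.inl k) p
      = diagChristoffel Sum.inl D.hCoeff i j k p := by
  have e : ∀ i j k, D.toDMetric.frameDeriv (Sum.inl k) (fun q => D.toDMetric.g q i j) p
      = if i = j then pd (Sum.inl k) (D.hCoeff i) p else 0 := by
    intro i j k
    rw [g_entry]
    split_ifs
    · rw [frameDeriv_hCoeff]
    · rw [DMetric.frameDeriv_zero]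
  simp only [DMetric.conn, e, hD.inv_g_apply hp, diagChristoffel, diagFirstKind]
  simp
  ring

theorem conn_inl_inl_inr (i j : Fin 3) (c : Fin 2) :
    D.toDMetric.conn (Sum.inl i) (Sum.inl j) (Sum.inr c) = fun _ => 0 := by
  have e : ∀ p i j, D.toDMetric.frameDeriv (Sum.inr c) (fun q => D.toDMetric.g q i j) p
      = 0 := by
    intro p i j
    rw [g_entry, DMetric.frameDeriv_inr]
    split_ifs
    · exact (indepOf_hCoeff (D := D) i (by simp) (by simp)).pd_eq_zero
    · exact pd_const 0
  funext p
  simp [DMetric.conn, e]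

include hD hp in
theorem conn_inr_inr_inr (a b c : Fin 2) :
    D.toDMetric.conn (Sum.inr a) (Sum.inr b) (Sum.inr c) p
      = diagChristoffel Sum.inr D.vCoeff a b c p := by
  have e : ∀ i j k, D.toDMetric.frameDeriv (Sum.inr k) (fun q => D.toDMetric.h q i j) p
      = if i = j then pd (Sum.inr k) (D.vCoeff i) p else 0 := by
    intro i j k
    rw [h_entry, DMetric.frameDeriv_inr]
    split_ifs
    · rfl
    · exact pd_const 0
  simp only [DMetric.conn, e, hD.inv_h_apply hp, diagChristoffel, diagFirstKind]
  simp
  ring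

include hD hU hp in
-- The closed form of the connection is known only on `U`, where the metric is invertible; openness
-- of `U` allows differentiating it. The N-part of $\delta_m$ acts by zero on functions of
-- $(x^2,x^3)$.
theorem frameDeriv_conn_inl_inl_inl (α : Idx) (i j k : Fin 3) :
    D.toDMetric.frameDeriv α (D.toDMetric.conn (Sum.inl i) (Sum.inl j) (Sum.inl k)) p
      = pd α (diagChristoffel Sum.inl D.hCoeff i j k) p := by
  have h : D.toDMetric.conn (Sum.inl i) (Sum.inl j) (Sum.inl k) =ᶠ[nhds p]
      diagChristoffel Sum.inl D.hCoeff i j k :=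
    Filter.eventually_of_mem (hU.mem_nhds hp) fun q hq => hD.conn_inl_inl_inl hq i j k
  rw [DMetric.frameDeriv_congr _ _ h]
  cases α with
  | inr a => rfl
  | inl m =>
    rw [DMetric.frameDeriv_inl]
    have z : ∀ a : Fin 2, pd (Sum.inr a) (diagChristoffel Sum.inl D.hCoeff i j k) p = 0 :=
      fun a => pd_diagChristoffel_of_indepOf (hD.contDiffAt_hCoeff hU hp) (hD.hCoeff_ne hp)
        (fun i => indepOf_hCoeff i (by simp) (by simp)) i j k
    simp [z]

include hD hU hp in
theorem frameDeriv_conn_inr_inr_inr (α : Idx) (a b c : Fin 2) :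
    D.toDMetric.frameDeriv α (D.toDMetric.conn (Sum.inr a) (Sum.inr b) (Sum.inr c)) p
      = D.toDMetric.frameDeriv α (diagChristoffel Sum.inr D.vCoeff a b c) p := by
  have h : D.toDMetric.conn (Sum.inr a) (Sum.inr b) (Sum.inr c) =ᶠ[nhds p]
      diagChristoffel Sum.inr D.vCoeff a b c :=
    Filter.eventually_of_mem (hU.mem_nhds hp) fun q hq => hD.conn_inr_inr_inr hq a b c
  rw [DMetric.frameDeriv_congr _ _ h]

include hD hU hp in
theorem differentiableAt_N (a : Fin 2) (i : Fin 3) :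
    DifferentiableAt ℝ (D.toDMetric.N a i) p :=
  (hD.contDiffAt_N hU hp a i).differentiableAt (by norm_num)

include hD hU hp in
theorem hRicci_eq_diagRicci (i j : Fin 3) :
    D.toDMetric.hRicci i j p = diagRicci Sum.inl D.hCoeff i j p := by
  simp only [DMetric.hRicci, DMetric.curvature, Fintype.sum_sum_type,
    hD.frameDeriv_conn_inl_inl_inl hU hp, hD.conn_inl_inl_inl hp, conn_inl_inl_inr,
    D.toDMetric.anholonomy_inl (hD.differentiableAt_N hU hp), diagRicci]
  simp [DMetric.conn]

include hD hU hp in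
theorem vRicci_eq_diagRicci (a b : Fin 2) :
    D.toDMetric.vRicci a b p = diagRicci Sum.inr D.vCoeff a b p := by
  simp only [DMetric.vRicci, DMetric.curvature, Fintype.sum_sum_type,
    hD.frameDeriv_conn_inr_inr_inr hU hp, hD.conn_inr_inr_inr hp, DMetric.frameDeriv_inr,
    DMetric.anholonomy_inr_inr, diagRicci]
  simp [DMetric.conn]

include hD hU hp in
theorem ricci_inl_inr (i : Fin 3) (a : Fin 2) :
    D.toDMetric.ricci (Sum.inl i) (Sum.inr a) p = 0 := by
  have z : ∀ i j k : Fin 3, pd (Sum.inr a) (diagChristoffel Sum.inl D.hCoeff i j k) p = 0 :=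
    fun i j k => pd_diagChristoffel_of_indepOf (hD.contDiffAt_hCoeff hU hp) (hD.hCoeff_ne hp)
      (fun i => indepOf_hCoeff i (by simp) (by simp)) i j k
  simp only [DMetric.ricci_inl, DMetric.curvature, Fintype.sum_sum_type,
    hD.frameDeriv_conn_inl_inl_inl hU hp, conn_inl_inl_inr, DMetric.frameDeriv_zero,
    D.toDMetric.anholonomy_inl (hD.differentiableAt_N hU hp), z]
  simp [DMetric.conn]

include hD hU hp in
theorem hRicci_relations :
    (∀ i j, i ≠ j → D.toDMetric.hRicci i j p = 0) ∧ D.toDMetric.hRicci 0 0 p = 0 ∧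
      (D.hCoeff 2 p)⁻¹ * D.toDMetric.hRicci 2 2 p
        = (D.hCoeff 1 p)⁻¹ * D.toDMetric.hRicci 1 1 p := by
  simp only [hD.hRicci_eq_diagRicci hU hp]
  exact diagRicci_fin_three_of_indepOf (hD.contDiffAt_hCoeff hU hp) (hD.hCoeff_ne hp)
    (fun i => indepOf_hCoeff i (by simp) (by simp)) ⟨D.g₁, rfl⟩

include hD hU hp in
theorem vRicci_relations :
    D.toDMetric.vRicci 0 1 p = 0 ∧ D.toDMetric.vRicci 1 0 p = 0 ∧
      (D.vCoeff 1 p)⁻¹ * D.toDMetric.vRicci 1 1 p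
        = (D.vCoeff 0 p)⁻¹ * D.toDMetric.vRicci 0 0 p := by
  simp only [hD.vRicci_eq_diagRicci hU hp]
  exact diagRicci_fin_two_of_indepOf (hD.contDiffAt_vCoeff hU hp) (hD.vCoeff_ne hp)
    indepOf_vCoeff

include hD hp in
theorem ricciMixed_eq (α β : Idx) :
    D.toDMetric.ricciMixed α β p
      = (Sum.elim (fun i => D.hCoeff i p) (fun a => D.vCoeff a p) α)⁻¹
        * D.toDMetric.ricci α β p := by
  simp [DMetric.ricciMixed, hD.inv_metric_apply hp]

include hD hp in
theorem hRicciMixed_eq (i j : Fin 3) :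
    D.toDMetric.hRicciMixed i j p = (D.hCoeff i p)⁻¹ * D.toDMetric.hRicci i j p := by
  simp [DMetric.hRicciMixed, hD.inv_g_apply hp]

include hD hp in
theorem vRicciMixed_eq (a b : Fin 2) :
    D.toDMetric.vRicciMixed a b p = (D.vCoeff a p)⁻¹ * D.toDMetric.vRicci a b p := by
  simp [DMetric.vRicciMixed, hD.inv_h_apply hp]

include hD hU hp in
theorem scalar_eq :
    D.toDMetric.scalar p
      = 2 * (D.toDMetric.hRicciMixed 1 1 p + D.toDMetric.vRicciMixed 0 0 p) := by
  obtain ⟨-, h1, h2⟩ := hD.hRicci_relations hU hp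
  obtain ⟨-, -, h3⟩ := hD.vRicci_relations hU hp
  simp only [DMetric.scalar, hD.inv_metric_apply hp, hD.hRicciMixed_eq hp, hD.vRicciMixed_eq hp]
  simp [Fintype.sum_sum_type, Fin.sum_univ_three, DMetric.ricci_inl_inl,
    DMetric.ricci_inr_inr, h1, h2, h3]
  ring

include hD hU hp in
theorem einstein_diag :
    D.toDMetric.einstein (Sum.inl 0) (Sum.inl 0) p
        = -(D.toDMetric.hRicciMixed 1 1 p + D.toDMetric.vRicciMixed 0 0 p) ∧
      D.toDMetric.einstein (Sum.inl 1) (Sum.inl 1) p = -D.toDMetric.vRicciMixed 0 0 p ∧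
      D.toDMetric.einstein (Sum.inl 2) (Sum.inl 2) p = -D.toDMetric.vRicciMixed 0 0 p ∧
      D.toDMetric.einstein (Sum.inr 0) (Sum.inr 0) p = -D.toDMetric.hRicciMixed 1 1 p ∧
      D.toDMetric.einstein (Sum.inr 1) (Sum.inr 1) p = -D.toDMetric.hRicciMixed 1 1 p := by
  obtain ⟨-, h1, h2⟩ := hD.hRicci_relations hU hp
  obtain ⟨-, -, h3⟩ := hD.vRicci_relations hU hp
  simp only [DMetric.einstein, hD.ricciMixed_eq hp, hD.scalar_eq hU hp, hD.hRicciMixed_eq hp,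
    hD.vRicciMixed_eq hp, DMetric.ricci_inl_inl, DMetric.ricci_inr_inr, Sum.elim_inl,
    Sum.elim_inr, h1, h2, h3]
  refine ⟨?_, ?_, ?_, ?_, ?_⟩ <;> simp

end IsRegularOn

end Ansatz

end AnholonomicFrame

end

/-! ### The components $R_{ai}$ and the choice of N-coefficients -/

noncomputable section

namespace AnholonomicFrame

namespace Ansatz

variable {D : Ansatz} {U : Set Pt} {p : Pt}

theorem pd_logRoot {r : WithTop ℕ∞} (hD : D.IsRegularOn r U) (hr : 1 ≤ r) (hU : IsOpen U)
    (hp : p ∈ U) (α : Idx) :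
    pd α D.logRoot p = 1 / 2 * ((D.vCoeff 0 p)⁻¹ * pd α (D.vCoeff 0) p
      + (D.vCoeff 1 p)⁻¹ * pd α (D.vCoeff 1) p) := by
  -- `Real.log` is even, so the absolute value disappears without a case split on signs.
  have e : D.logRoot = fun q => 1 / 2 * Real.log (D.vCoeff 0 q * D.vCoeff 1 q) := by
    funext q
    simp only [logRoot]
    rw [Real.log_sqrt (abs_nonneg _), Real.log_abs]
    simp only [vCoeff, Matrix.cons_val_zero, Matrix.cons_val_one]
    ring
  have d := fun a => ((hD.contDiffAt_vCoeff hU hp a).differentiableAt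
    (fun h => by simp [h] at hr)).hasFDerivAt
  have h0 := hD.vCoeff_ne hp 0
  have h1 := hD.vCoeff_ne hp 1
  have h := (((d 0).fun_mul (d 1)).log (mul_ne_zero h0 h1)).const_mul (1 / 2)
  rw [e, pd, h.fderiv]
  simp only [pd]
  simp
  field_simp
  ring

/-- The coefficients `Γ^a_{ak}` when `N_i^5 = 0`. -/
def mixedCoeff (D : Ansatz) (a : Fin 2) (k : Fin 3) (p : Pt) : ℝ :=
  1 / 2 * (D.vCoeff a p)⁻¹ * (pd (Sum.inl k) (D.vCoeff a) p
    - D.toDMetric.N 0 k p * pd (Sum.inr 0) (D.vCoeff a) p)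

theorem pd_mixedCoeff (hD : D.IsRegularOn 2 U) (hU : IsOpen U) (hp : p ∈ U) (α : Idx)
    (a : Fin 2) (k : Fin 3) :
    pd α (D.mixedCoeff a k) p = 1 / 2 * ((D.vCoeff a p)⁻¹ *
        (pd α (pd (Sum.inl k) (D.vCoeff a)) p
          - (D.toDMetric.N 0 k p * pd α (pd (Sum.inr 0) (D.vCoeff a)) p
            + pd (Sum.inr 0) (D.vCoeff a) p * pd α (D.toDMetric.N 0 k) p))
      - (D.vCoeff a p)⁻¹ ^ 2 * pd α (D.vCoeff a) p *
        (pd (Sum.inl k) (D.vCoeff a) p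
          - D.toDMetric.N 0 k p * pd (Sum.inr 0) (D.vCoeff a) p)) := by
  have hH := hD.contDiffAt_vCoeff hU hp a
  have hN := hD.differentiableAt_N hU hp 0 k
  have d1 : ∀ β, DifferentiableAt ℝ (pd β (D.vCoeff a)) p := fun β => differentiableAt_pd hH
  have d2 := hN.fun_mul (d1 (Sum.inr 0))
  unfold mixedCoeff
  rw [pd_half_inv_mul (hH.differentiableAt (by norm_num)) ((d1 _).fun_sub d2)
    (hD.vCoeff_ne hp a), pd_sub (d1 _) d2, pd_mul hN (d1 _)]

namespace IsRegularOn

variable (hD : D.IsRegularOn 2 U) (hU : IsOpen U) (hp : p ∈ U)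
  (hn : ∀ i, D.toDMetric.N 1 i = fun _ => 0)

include hD hp hn in
-- For $a=b$ the term $\partial_aN^a_k$ cancels the two subtracted ones. For $a\ne b$ every term
-- contains $\partial_5w_k$ or $\partial_vn_k$, both zero.
theorem conn_inr_inr_inl (a b : Fin 2) (k : Fin 3) :
    D.toDMetric.conn (Sum.inr a) (Sum.inr b) (Sum.inl k) p
      = if a = b then D.mixedCoeff a k p else 0 := by
  have e : ∀ i j, D.toDMetric.frameDeriv (Sum.inl k) (fun q => D.toDMetric.h q i j) p
      = if i = j then pd (Sum.inl k) (D.vCoeff i) p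
          - D.toDMetric.N 0 k p * pd (Sum.inr 0) (D.vCoeff i) p else 0 := by
    intro i j
    rw [h_entry]
    split_ifs
    · simp [DMetric.frameDeriv_inl, (indepOf_vCoeff (D := D) i).pd_eq_zero]
    · rw [DMetric.frameDeriv_zero]
  have z : pd (Sum.inr 1) (D.toDMetric.N 0 k) p = 0 := (indepOf_N 0 k).pd_eq_zero
  have h0 := hD.vCoeff_ne hp
  simp only [DMetric.conn, e, hD.inv_h_apply hp]
  simp only [toDMetric_h, Matrix.diagonal_apply, DMetric.frameDeriv_inr, Fin.sum_univ_two,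
    mixedCoeff]
  have h00 := h0 0
  have h01 := h0 1
  fin_cases a <;> fin_cases b <;> simp [z, hn, pd_const]
  · field_simp
    ring
  · ring

include hD hU hp hn in
theorem frameDeriv_conn_inr_inr_inl (α : Idx) (a b : Fin 2) (k : Fin 3) :
    D.toDMetric.frameDeriv α (D.toDMetric.conn (Sum.inr a) (Sum.inr b) (Sum.inl k)) p
      = if a = b then D.toDMetric.frameDeriv α (D.mixedCoeff a k) p else 0 := by
  have h : D.toDMetric.conn (Sum.inr a) (Sum.inr b) (Sum.inl k) =ᶠ[nhds p]
      fun q => if a = b then D.mixedCoeff a k q else 0 :=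
    Filter.eventually_of_mem (hU.mem_nhds hp) fun q hq => hD.conn_inr_inr_inl hq hn a b k
  rw [DMetric.frameDeriv_congr _ _ h]
  split_ifs
  · rfl
  · exact DMetric.frameDeriv_zero _ _

include hD hU hp hn in
-- In $R_4{}^4{}_{i4}$ the commutator of $\partial_v$ and $\delta_i$ cancels the anholonomy term, so
-- no derivative of $w_i$ survives. What remains of $R_{4i}$ is
-- $R_4{}^5{}_{i5}=-\frac1{2h_5}\bigl(\delta_ih_5^*-h_5^*\,\delta_i\ln\sqrt{|h_4h_5|}\bigr)$;
-- inserting $\delta_i=\partial_i-w_i\partial_v$ gives $\alpha_i-w_i\beta$.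
theorem ricci_inr_inl (i : Fin 3) :
    D.toDMetric.ricci (Sum.inr 0) (Sum.inl i) p
        = -(1 / 2) * (D.vCoeff 1 p)⁻¹ *
          (D.alphaCoeff i p - D.toDMetric.N 0 i p * D.betaCoeff p) ∧
      D.toDMetric.ricci (Sum.inr 1) (Sum.inl i) p = 0 := by
  have hv := hD.contDiffAt_vCoeff hU hp
  have h0 := hD.vCoeff_ne hp
  have z := fun a => (indepOf_vCoeff (D := D) a).pd_eq_zero (p := p)
  have zz := fun β a => ((indepOf_vCoeff (D := D) a).pd (β := β)).pd_eq_zero (p := p)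
  have zz' := fun β a => (pd_comm (hv a)).trans (zz β a)
  have zN : pd (Sum.inr 1) (D.toDMetric.N 0 i) p = 0 := (indepOf_N 0 i).pd_eq_zero
  have s := fun a => pd_comm (α := Sum.inr 0) (β := Sum.inl i) (hv a)
  have hstar : D.h₅star = pd (Sum.inr 0) (D.vCoeff 1) := rfl
  have h00 := h0 0
  have h01 := h0 1
  simp only [DMetric.ricci_inr, DMetric.curvature, Fintype.sum_sum_type,
    hD.frameDeriv_conn_inr_inr_inl hU hp hn, hD.frameDeriv_conn_inr_inr_inr hU hp,
    hD.conn_inr_inr_inl hp hn, hD.conn_inr_inr_inr hp,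
    D.toDMetric.anholonomy_inl (hD.differentiableAt_N hU hp),
    D.toDMetric.anholonomy_inr_inl_inr (hD.differentiableAt_N hU hp),
    DMetric.frameDeriv_inl, DMetric.frameDeriv_inr, Fin.sum_univ_two, hn, pd_const,
    pd_mixedCoeff hD hU hp, pd_diagChristoffel hv h0, alphaCoeff, betaCoeff, hstar,
    pd_logRoot hD (by norm_num) hU hp]
  simp [DMetric.conn, mixedCoeff, diagChristoffel, diagFirstKind, z, zz, zz', zN, s]
  field_simp
  ring

include hD hU hp hn in
theorem offDiag_eq_zero (hw : ∀ i, D.alphaCoeff i p - D.toDMetric.N 0 i p * D.betaCoeff p = 0)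
    {α β : Idx} (h : α ≠ β) :
    D.toDMetric.ricci α β p = 0 ∧ D.toDMetric.einstein α β p = 0 := by
  have key : D.toDMetric.ricci α β p = 0 := by
    rcases α with i | a <;> rcases β with j | b
    · rw [DMetric.ricci_inl_inl]
      exact (hD.hRicci_relations hU hp).1 i j fun e => h (by rw [e])
    · exact hD.ricci_inl_inr hU hp i b
    · obtain ⟨h1, h2⟩ := hD.ricci_inr_inl hU hp hn j
      fin_cases a
      · exact h1.trans (by rw [hw j, mul_zero])
      · exact h2
    · rw [DMetric.ricci_inr_inr]
      obtain ⟨h1, h2, -⟩ := hD.vRicci_relations hU hp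
      fin_cases a <;> fin_cases b
      · exact absurd rfl h
      · exact h1
      · exact h2
      · exact absurd rfl h
  refine ⟨key, ?_⟩
  simp [DMetric.einstein, hD.ricciMixed_eq hp, key, h]

end IsRegularOn

/-- The value at `(x, v)` of a function on the coordinate space, taken at `y⁵ = 0`. -/
def restrictXV (F : Pt → ℝ) (x : Fin 3 → ℝ) (v : ℝ) : ℝ := F (Sum.elim x ![v, 0])

/-- Setting $y^5=0$ may leave `U`; this is harmless because `IndepOf` is global. -/
theorem liftXV_restrictXV {F : Pt → ℝ} (hF : IndepOf (Sum.inr 1) F) :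
    liftXV (restrictXV F) = F := by
  funext p
  have : Sum.elim (fun i => p (Sum.inl i)) ![p (Sum.inr 0), 0]
      = p + (-p (Sum.inr 1)) • basisVec (Sum.inr 1) := by
    funext α
    rcases α with i | a
    · simp [basisVec]
    · fin_cases a <;> simp [basisVec]
  rw [liftXV, restrictXV, this, hF]

theorem indepOf_h₅star : IndepOf (Sum.inr 1) D.h₅star := (indepOf_liftXV _).pd

theorem indepOf_logRoot : IndepOf (Sum.inr 1) D.logRoot := by
  intro p t
  simp only [logRoot, indepOf_liftXV _ p t]

theorem indepOf_alphaCoeff (i : Fin 3) : IndepOf (Sum.inr 1) (D.alphaCoeff i) := by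
  intro p t
  simp only [alphaCoeff, indepOf_h₅star.pd p t, indepOf_h₅star p t, indepOf_logRoot.pd p t]

theorem indepOf_betaCoeff : IndepOf (Sum.inr 1) D.betaCoeff := by
  intro p t
  simp only [betaCoeff, indepOf_h₅star.pd p t, indepOf_h₅star p t, indepOf_logRoot.pd p t]

theorem contDiffAt_logRoot (hD : D.IsRegularOn ∞ U) (hU : IsOpen U) (hp : p ∈ U) :
    ContDiffAt ℝ ∞ D.logRoot p := by
  have h0 : liftXV D.h₄ p * liftXV D.h₅ p ≠ 0 := mul_ne_zero (hD.h₄_ne p hp) (hD.h₅_ne p hp)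
  have h := (hD.contDiffAt_vCoeff hU hp 0).mul (hD.contDiffAt_vCoeff hU hp 1)
  have ha : ContDiffAt ℝ ∞ (fun q => |liftXV D.h₄ q * liftXV D.h₅ q|) p :=
    ContDiffAt.comp (g := fun x : ℝ => |x|) p (contDiffAt_abs h0) h
  exact (ha.sqrt (abs_ne_zero.2 h0)).log (Real.sqrt_ne_zero'.2 (abs_pos.2 h0))

theorem contDiffAt_h₅star (hD : D.IsRegularOn ∞ U) (hU : IsOpen U) (hp : p ∈ U) :
    ContDiffAt ℝ ∞ D.h₅star p :=
  ContDiffAt.pd (hD.contDiffAt_vCoeff hU hp 1) le_rfl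

theorem contDiffAt_alphaCoeff (hD : D.IsRegularOn ∞ U) (hU : IsOpen U) (hp : p ∈ U)
    (i : Fin 3) : ContDiffAt ℝ ∞ (D.alphaCoeff i) p :=
  (ContDiffAt.pd (contDiffAt_h₅star hD hU hp) le_rfl).sub
    ((contDiffAt_h₅star hD hU hp).mul (ContDiffAt.pd (contDiffAt_logRoot hD hU hp) le_rfl))

theorem contDiffAt_betaCoeff (hD : D.IsRegularOn ∞ U) (hU : IsOpen U) (hp : p ∈ U) :
    ContDiffAt ℝ ∞ D.betaCoeff p :=
  (ContDiffAt.pd (contDiffAt_h₅star hD hU hp) le_rfl).sub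
    ((contDiffAt_h₅star hD hU hp).mul (ContDiffAt.pd (contDiffAt_logRoot hD hU hp) le_rfl))

theorem IsRegularOn.withN {r : WithTop ℕ∞} (hD : D.IsRegularOn r U)
    {w' n' : Fin 3 → (Fin 3 → ℝ) → ℝ → ℝ} (hw : ∀ i, ContDiffOn ℝ r (liftXV (w' i)) U)
    (hn : ∀ i, ContDiffOn ℝ r (liftXV (n' i)) U) : (D.withN w' n').IsRegularOn r U where
  g₁_eq := hD.g₁_eq
  g₂_smooth := hD.g₂_smooth
  g₃_smooth := hD.g₃_smooth
  h₄_smooth := hD.h₄_smooth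
  h₅_smooth := hD.h₅_smooth
  w_smooth := hw
  n_smooth := hn
  g₂_ne := hD.g₂_ne
  g₃_ne := hD.g₃_ne
  h₄_ne := hD.h₄_ne
  h₅_ne := hD.h₅_ne

theorem exists_smooth_w (hD : D.IsRegularOn ∞ U) (hU : IsOpen U)
    (h : (∀ p ∈ U, D.betaCoeff p ≠ 0) ∨
      (∀ p ∈ U, D.betaCoeff p = 0 ∧ ∀ i, D.alphaCoeff i p = 0)) :
    ∃ w' : Fin 3 → (Fin 3 → ℝ) → ℝ → ℝ, (∀ i, ContDiffOn ℝ ∞ (liftXV (w' i)) U) ∧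
      ∀ p ∈ U, ∀ i, D.alphaCoeff i p - liftXV (w' i) p * D.betaCoeff p = 0 := by
  rcases h with h | h
  · have e : ∀ i, liftXV (restrictXV fun q => D.alphaCoeff i q / D.betaCoeff q)
        = fun q => D.alphaCoeff i q / D.betaCoeff q := fun i =>
      liftXV_restrictXV fun p t => by
        simp only [indepOf_alphaCoeff i p t, indepOf_betaCoeff p t]
    refine ⟨fun i => restrictXV fun q => D.alphaCoeff i q / D.betaCoeff q, fun i p hp => ?_,
      fun p hp i => ?_⟩
    · rw [e]
      exact ((contDiffAt_alphaCoeff hD hU hp i).fun_div (contDiffAt_betaCoeff hD hU hp)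
        (h p hp)).contDiffWithinAt
    · rw [e, div_mul_cancel₀ _ (h p hp), sub_self]
  -- Here the equation reads $0=0$ and any smooth $w_i$ would do.
  · refine ⟨fun _ _ _ => 0, fun _ => contDiffOn_const, fun p hp i => ?_⟩
    rw [(h p hp).1, (h p hp).2 i, mul_zero, sub_zero]

end Ansatz

end AnholonomicFrame

end

open AnholonomicFrame in
theorem corollary1 (U : Set Pt) (hU : IsOpen U) (D : Ansatz) (hD : D.IsRegularOn 2 U) :
    -- the diagonal components of the Einstein tensor
    (∀ p ∈ U,
      D.toDMetric.einstein (Sum.inl 0) (Sum.inl 0) p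
          = -(D.toDMetric.hRicciMixed 1 1 p + D.toDMetric.vRicciMixed 0 0 p) ∧
      D.toDMetric.einstein (Sum.inl 1) (Sum.inl 1) p = -D.toDMetric.vRicciMixed 0 0 p ∧
      D.toDMetric.einstein (Sum.inl 2) (Sum.inl 2) p = -D.toDMetric.vRicciMixed 0 0 p ∧
      D.toDMetric.einstein (Sum.inr 0) (Sum.inr 0) p = -D.toDMetric.hRicciMixed 1 1 p ∧
      D.toDMetric.einstein (Sum.inr 1) (Sum.inr 1) p = -D.toDMetric.hRicciMixed 1 1 p) ∧
    -- the diagonal vacuum equations are equations for the two values `R^2_2` and `S^4_4`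
    (∀ p ∈ U,
      (∀ α : Idx, D.toDMetric.einstein α α p = 0) ↔
        D.toDMetric.hRicciMixed 1 1 p = 0 ∧ D.toDMetric.vRicciMixed 0 0 p = 0) ∧
    -- these two values do not depend on the N-coefficients
    (∀ w' n' : Fin 3 → (Fin 3 → ℝ) → ℝ → ℝ, (D.withN w' n').IsRegularOn 2 U →
      ∀ p ∈ U,
        (D.withN w' n').toDMetric.hRicciMixed 1 1 p = D.toDMetric.hRicciMixed 1 1 p ∧
        (D.withN w' n').toDMetric.vRicciMixed 0 0 p = D.toDMetric.vRicciMixed 0 0 p) ∧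
    -- a choice of the N-coefficients makes all non-diagonal components vanish
    (D.IsRegularOn ∞ U →
      ((∀ p ∈ U, D.betaCoeff p ≠ 0) ∨
        (∀ p ∈ U, D.betaCoeff p = 0 ∧ ∀ i, D.alphaCoeff i p = 0)) →
      ∃ w' n' : Fin 3 → (Fin 3 → ℝ) → ℝ → ℝ, (D.withN w' n').IsRegularOn ∞ U ∧
        ∀ p ∈ U, ∀ α β : Idx, α ≠ β →
          (D.withN w' n').toDMetric.ricci α β p = 0 ∧
          (D.withN w' n').toDMetric.einstein α β p = 0) := by
  refine ⟨fun p hp => hD.einstein_diag hU hp, fun p hp => ?_, fun w' n' hD' p hp => ?_,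
    fun hs h => ?_⟩
  · obtain ⟨h0, h1, h2, h3, h4⟩ := hD.einstein_diag hU hp
    constructor
    · intro h
      exact ⟨neg_eq_zero.1 (h3 ▸ h (Sum.inr 0)), neg_eq_zero.1 (h1 ▸ h (Sum.inl 1))⟩
    · rintro ⟨hR, hS⟩ (i | a)
      · fin_cases i
        · exact h0.trans (by rw [hR, hS, add_zero, neg_zero])
        · exact h1.trans (by rw [hS, neg_zero])
        · exact h2.trans (by rw [hS, neg_zero])
      · fin_cases a
        · exact h3.trans (by rw [hR, neg_zero])
        · exact h4.trans (by rw [hR, neg_zero])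
  -- After reduction to `diagRicci` both sides involve only the $g_i$ and $h_a$, which `withN`
  -- leaves unchanged.
  · rw [hD'.hRicciMixed_eq hp, hD.hRicciMixed_eq hp, hD'.vRicciMixed_eq hp,
      hD.vRicciMixed_eq hp, hD'.hRicci_eq_diagRicci hU hp, hD.hRicci_eq_diagRicci hU hp,
      hD'.vRicci_eq_diagRicci hU hp, hD.vRicci_eq_diagRicci hU hp]
    exact ⟨rfl, rfl⟩
  · obtain ⟨w', hw, hw'⟩ := Ansatz.exists_smooth_w hs hU h
    have hr : (D.withN w' fun _ _ _ => 0).IsRegularOn ∞ U :=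
      hs.withN hw fun _ => contDiffOn_const
    have h2 := hr.of_le (s := 2) (WithTop.coe_le_coe.2 (le_top : (2 : ℕ∞) ≤ ⊤))
    exact ⟨w', fun _ _ _ => 0, hr, fun p hp α β hαβ =>
      h2.offDiag_eq_zero hU hp (fun _ => rfl) (hw' p hp) hαβ⟩
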